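/- Let $k$ be a field, let $Y$, $Z$, $X_n$ ($n\ge 1$), $T_n$ ($n\ge1$) be independent indeterminates over $k$, put $A=k[Y,Z,X_n,T_n : n\ge 1]$ and let $K$ be the field of fractions of $A$. Let $S$ be the monoid of all monomials $f$ of $A$ (including $1$) such that (a) if $Z$ occurs in $f$, then some $X_n$ occurs in $f$; (b) for all $n\ge 1$, if $T_n$ occurs in $f$, then $Y$ occurs in $f$ or some $X_i$ with $i\le n$ occurs in $f$. Let $R=k[S]\subseteq A$ be the $k$-span of $S$ (its field of fractions is $K$), let $P=(X_n : n\ge 1)A\cap R$, and let $M$ be the ideal of $R$ generated by $S\setminus\{1\}$. For nonzero fractional ideals $I,J$ of $R$ put $(J:I)=\{x\in K : xI\subseteq J\}$, $I_v=(R:(R:I))$ and $I_t=\bigcup J_v$, the union being over all nonzero finitely generated fractional ideals $J\subseteq I$. A nonzero fractional ideal $I$ is called divisorial if $I=I_v$, a $t$-ideal if $I=I_t$, and strong if $(R:I)=(I:I)$. A maximal divisorial ideal (respectively, a $t$-maximal ideal) is an ideal that is maximal among the divisorial ideals (respectively, the $t$-ideals) properly contained in $R$. Then: 1. $R$ is integrally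 closed. 2. $P=RZ^{-1}\cap R$. 3. $(R:P)=R[Z]$. 4. $P$ is strong and is a maximal divisorial ideal of $R$. 5. $M$ is a maximal ideal of $R$ and a $t$-ideal, and $P\subsetneq M$; in particular $P$ is not $t$-maximal. -/

import Mathlib

open scoped nonZeroDivisors

namespace StarOperation

section Definitions

variable {R : Type*} [CommRing R] [IsDomain R] {K : Type*} [Field K] [Algebra R K]
  [IsFractionRing R K]

/-- The `v`-closure `I_v = (R : (R : I))` of a nonzero fractional ideal `I`; the quotient
`J / I` of fractional ideals is `(J : I) = {x ∈ K | x I ⊆ J}` and `1` is `R` itself. -/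
noncomputable def vClosure (I : FractionalIdeal R⁰ K) : FractionalIdeal R⁰ K :=
  1 / (1 / I)

/-- The `t`-closure `I_t = ⋃ J_v`, the union over all nonzero finitely generated
fractional ideals `J` contained in `I`. -/
def tClosure (I : FractionalIdeal R⁰ K) : Set K :=
  {x | ∃ J : FractionalIdeal R⁰ K,
    J ≠ 0 ∧ (J : Submodule R K).FG ∧ J ≤ I ∧ x ∈ vClosure J}

/-- A divisorial ideal (a `v`-ideal): a nonzero fractional ideal with `I_v = I`. -/
def IsDivisorial (I : FractionalIdeal R⁰ K) : Prop :=
  I ≠ 0 ∧ vClosure I = I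

/-- A `t`-ideal: a nonzero fractional ideal with `I_t = I`. -/
def IsTIdeal (I : FractionalIdeal R⁰ K) : Prop :=
  I ≠ 0 ∧ tClosure I = {x : K | x ∈ I}

/-- A strong ideal: a nonzero fractional ideal with `(R : I) = (I : I)`. -/
def IsStrong (I : FractionalIdeal R⁰ K) : Prop :=
  I ≠ 0 ∧ 1 / I = I / I

end Definitions

section Maximal

variable {R : Type*} [CommRing R] [IsDomain R] (K : Type*) [Field K] [Algebra R K]
  [IsFractionRing R K]

/-- A maximal divisorial ideal: maximal among the proper integral divisorial ideals. -/
def IsMaximalDivisorial (P : Ideal R) : Prop :=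
  Maximal (fun I : Ideal R => I ≠ ⊤ ∧ IsDivisorial (I : FractionalIdeal R⁰ K)) P

/-- A `t`-maximal ideal: maximal among the proper integral `t`-ideals. -/
def IsTMaximal (P : Ideal R) : Prop :=
  Maximal (fun I : Ideal R => I ≠ ⊤ ∧ IsTIdeal (I : FractionalIdeal R⁰ K)) P

end Maximal

end StarOperation

namespace MonomialExample

/-- The indeterminates `Y`, `Z`, `X_n` and `T_n` for `n ≥ 1`. -/
inductive Var : Type
  | Y : Var
  | Z : Var
  | X (n : ℕ+) : Var
  | T (n : ℕ+) : Var

/-- The monoid `S` of monomials, written through their exponent vectors. The variable `v`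
occurs in the monomial `f` when its exponent `f v` is nonzero. -/
def S : AddSubmonoid (Var →₀ ℕ) where
  carrier := {f |
    (f Var.Z ≠ 0 → ∃ n, f (Var.X n) ≠ 0) ∧
    ∀ n, f (Var.T n) ≠ 0 → f Var.Y ≠ 0 ∨ ∃ i, i ≤ n ∧ f (Var.X i) ≠ 0}
  zero_mem' := by simp
  add_mem' := by
    rintro f g ⟨hf, hf'⟩ ⟨hg, hg'⟩
    have key : ∀ v, (f + g) v ≠ 0 ↔ f v ≠ 0 ∨ g v ≠ 0 := by
      intro v
      rw [Finsupp.add_apply]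
      omega
    refine ⟨fun h => ?_, fun n h => ?_⟩
    · rcases (key _).1 h with h | h
      · obtain ⟨n, hn⟩ := hf h
        exact ⟨n, (key _).2 (Or.inl hn)⟩
      · obtain ⟨n, hn⟩ := hg h
        exact ⟨n, (key _).2 (Or.inr hn)⟩
    · rcases (key _).1 h with h | h
      · rcases hf' n h with h1 | ⟨i, hi, h1⟩
        · exact Or.inl ((key _).2 (Or.inl h1))
        · exact Or.inr ⟨i, hi, (key _).2 (Or.inl h1)⟩
      · rcases hg' n h with h1 | ⟨i, hi, h1⟩
        · exact Or.inl ((key _).2 (Or.inr h1))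
        · exact Or.inr ⟨i, hi, (key _).2 (Or.inr h1)⟩

variable (k : Type*) [Field k]

/-- The semigroup ring `R = k[S]`: the polynomials over `k` all of whose monomials are
in `S`, that is, the `k`-span of `S`. -/
noncomputable def R : Subalgebra k (MvPolynomial Var k) where
  carrier := {p | ∀ m ∈ p.support, m ∈ S}
  mul_mem' := by
    classical
    intro p q hp hq m hm
    obtain ⟨a, ha, b, hb, rfl⟩ := Finset.mem_add.1 (MvPolynomial.support_mul p q hm)
    exact S.add_mem (hp a ha) (hq b hb)
  add_mem' := by
    classical
    intro p q hp hq m hm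
    rcases Finset.mem_union.1 (MvPolynomial.support_add hm) with h | h
    · exact hp m h
    · exact hq m h
  algebraMap_mem' := by
    classical
    intro c m hm
    rw [MvPolynomial.algebraMap_eq, MvPolynomial.mem_support_iff, MvPolynomial.coeff_C] at hm
    have h0 : m = 0 := by
      by_contra h
      exact hm (if_neg (fun h' => h h'.symm))
    rw [h0]
    exact S.zero_mem

/-- The monomial ideal `P = (X_n : n ≥ 1) k[Y, Z, X, T] ∩ R`. -/
noncomputable def P : Ideal (R k) :=
  (Ideal.span (Set.range fun n : ℕ+ => (MvPolynomial.X (Var.X n) : MvPolynomial Var k))).comap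
    (R k).val

/-- The ideal `M` of `R` generated by the monomials `s ≠ 1` of `S`. -/
noncomputable def M : Ideal (R k) :=
  Ideal.span {p | ∃ s : Var →₀ ℕ, s ∈ S ∧ s ≠ 0 ∧
    (p : MvPolynomial Var k) = MvPolynomial.monomial s 1}

/-- For every polynomial `p` there is a nonzero `d ∈ R` with `d p ∈ R`
(take `d = X_1`). -/
theorem X_one_mul_mem (p : MvPolynomial Var k) :
    MvPolynomial.X (Var.X 1) * p ∈ R k := by
  classical
  intro m hm
  rw [MvPolynomial.support_X_mul, Finset.mem_map] at hm
  obtain ⟨a, -, rfl⟩ := hm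
  have h : (Finsupp.single (Var.X 1) 1 + a : Var →₀ ℕ) (Var.X 1) ≠ 0 := by
    simp
  exact ⟨fun _ => ⟨1, h⟩, fun n _ => Or.inr ⟨1, one_le, h⟩⟩

theorem algebraMap_injective_R (K : Type*) [Field K] [Algebra (MvPolynomial Var k) K]
    [IsFractionRing (MvPolynomial Var k) K] :
    Function.Injective (algebraMap (R k) K) := fun _ _ hab =>
  Subtype.ext (IsFractionRing.injective (MvPolynomial Var k) K hab)

theorem exists_div_R (K : Type*) [Field K] [Algebra (MvPolynomial Var k) K]
    [IsFractionRing (MvPolynomial Var k) K] (w : K) :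
    ∃ x y : R k, w = algebraMap (R k) K x / algebraMap (R k) K y := by
  obtain ⟨a, b, -, rfl⟩ := IsFractionRing.div_surjective (A := MvPolynomial Var k) w
  have hX : algebraMap (MvPolynomial Var k) K (MvPolynomial.X (Var.X 1)) ≠ 0 := fun h =>
    MvPolynomial.X_ne_zero (R := k) (Var.X 1)
      (IsFractionRing.injective (MvPolynomial Var k) K (h.trans (map_zero _).symm))
  refine ⟨⟨MvPolynomial.X (Var.X 1) * a, X_one_mul_mem k a⟩,
    ⟨MvPolynomial.X (Var.X 1) * b, X_one_mul_mem k b⟩, ?_⟩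
  have e : ∀ p : MvPolynomial Var k,
      algebraMap (R k) K ⟨MvPolynomial.X (Var.X 1) * p, X_one_mul_mem k p⟩ =
        algebraMap (MvPolynomial Var k) K (MvPolynomial.X (Var.X 1) * p) := fun p => rfl
  rw [e a, e b, map_mul, map_mul]
  exact (mul_div_mul_left _ _ hX).symm

/-- The quotient field of `R` is the field of rational functions in all the variables. -/
instance isFractionRing_R (K : Type*) [Field K] [Algebra (MvPolynomial Var k) K]
    [IsFractionRing (MvPolynomial Var k) K] : IsFractionRing (R k) K := by
  have : FaithfulSMul (R k) K :=
    (faithfulSMul_iff_algebraMap_injective (R k) K).2 (algebraMap_injective_R k K)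
  exact IsFractionRing.of_field (R k) K (exists_div_R k K)

end MonomialExample

/-!
Each of the conditions (a) and (b) says that a variable `v` (`Z`, respectively `T_n`) occurs only
in the company of a set `E` of variables (all the `X_i`, respectively `Y` and the `X_i` with
`i ≤ n`). Setting the variables of `E` to `0` turns such a condition on the monomials of `p` into
the statement that the image of `p` has degree `0` in `v`. Over a domain this gives integral
closedness, a cancellation rule for factors outside the ideal `(E)`, and the equivalence of
`v p ∈ R` with `p ∈ (E)` for `p ∈ R`.

For `v = Z` the equivalence says `P = R Z⁻¹ ∩ R`, an intersection of two divisorial ideals, and the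
cancellation rule makes `P` maximal divisorial. For `v = T_n` it exhibits `M` as the increasing
union of the ideals `{p ∈ R | T_n p ∈ R}`, so `T_n J ⊆ R` for large `n` whenever `J ⊆ M` is
finitely generated, which keeps `J_v` inside `M`.
-/

namespace MonomialExample

section GuardedMonomials

open MvPolynomial

variable {σ : Type*}

/-- The subalgebra `A[N]` of the polynomial ring: the polynomials all of whose monomials lie in
the monoid `N` of exponent vectors. -/
noncomputable def monomialSubalgebra (A : Type*) [CommSemiring A] (N : AddSubmonoid (σ →₀ ℕ)) :
    Subalgebra A (MvPolynomial σ A) :=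
  (restrictSupport A (N : Set (σ →₀ ℕ))).toSubalgebra
    ((monomial_mem_restrictSupport A).2 (Or.inl N.zero_mem)) fun _ _ hp hq =>
      restrictSupport_mono A (Set.add_subset_iff.2 fun _ ha _ hb => N.add_mem ha hb)
        (restrictSupport_add A (N : Set (σ →₀ ℕ)) N ▸ Submodule.mul_mem_mul hp hq)

/-- The monoid of monomials in which `v` occurs only together with some variable of `E`. Both
conditions (a) and (b) defining `S` are of this form. -/
def guarded (E : Set σ) (v : σ) : AddSubmonoid (σ →₀ ℕ) where
  carrier := {m | m v ≠ 0 → ∃ w ∈ E, m w ≠ 0}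
  zero_mem' h := absurd rfl h
  add_mem' {m n} hm hn h := by
    simp only [Finsupp.add_apply, ne_eq, Nat.add_eq_zero_iff, not_and_or] at h ⊢
    rcases h with h | h
    · exact (hm h).imp fun w hw => hw.imp_right Or.inl
    · exact (hn h).imp fun w hw => hw.imp_right Or.inr

/-- The substitution of `0` for the variables of `E`, with values in the polynomial ring in the
remaining variables. -/
noncomputable def killVars (A : Type*) [CommSemiring A] (E : Set σ) :
    MvPolynomial σ A →ₐ[A] MvPolynomial (Eᶜ : Set σ) A :=
  killCompl Subtype.val_injective

section CommSemiring

variable {A : Type*} [CommSemiring A] {N N' : AddSubmonoid (σ →₀ ℕ)} {E : Set σ} {v w : σ}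
  {p : MvPolynomial σ A}

theorem mem_monomialSubalgebra : p ∈ monomialSubalgebra A N ↔ ∀ m ∈ p.support, m ∈ N := Iff.rfl

theorem mem_monomialSubalgebra_inf : p ∈ monomialSubalgebra A (N ⊓ N') ↔
    p ∈ monomialSubalgebra A N ∧ p ∈ monomialSubalgebra A N' := by
  simp only [mem_monomialSubalgebra, AddSubmonoid.mem_inf, forall_and]

theorem mem_monomialSubalgebra_iInf {ι : Sort*} {N : ι → AddSubmonoid (σ →₀ ℕ)} :
    p ∈ monomialSubalgebra A (⨅ i, N i) ↔ ∀ i, p ∈ monomialSubalgebra A (N i) := by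
  simp only [mem_monomialSubalgebra, AddSubmonoid.mem_iInf]
  exact ⟨fun h i m hm => h m hm i, fun h m hm i => h i m hm⟩

theorem monomial_mem_monomialSubalgebra {m : σ →₀ ℕ} (hm : m ∈ N) (c : A) :
    monomial m c ∈ monomialSubalgebra A N :=
  (monomial_mem_restrictSupport A).2 (Or.inl hm)

theorem mem_guarded {m : σ →₀ ℕ} : m ∈ guarded E v ↔ (m v ≠ 0 → ∃ w ∈ E, m w ≠ 0) := Iff.rfl

theorem erase_mem_guarded {m : σ →₀ ℕ} (hm : m ∈ guarded E v) (hw : w ∉ E) :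
    m.erase w ∈ guarded E v := by
  classical
  intro hv
  obtain ⟨u, hu, hmu⟩ := hm fun h => hv (by rw [Finsupp.erase_apply, h, ite_self])
  exact ⟨u, hu, by rwa [Finsupp.erase_ne (ne_of_mem_of_not_mem hu hw)]⟩

theorem mem_monomialSubalgebra_guarded_of_mem_span (v : σ)
    (hp : p ∈ Ideal.span ((X : σ → MvPolynomial σ A) '' E)) :
    p ∈ monomialSubalgebra A (guarded E v) :=
  fun m hm _ => mem_ideal_span_X_image.1 hp m hm

theorem constantCoeff_eq_zero_of_mem_span
    (hp : p ∈ Ideal.span ((X : σ → MvPolynomial σ A) '' E)) : constantCoeff p = 0 := by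
  by_contra h
  obtain ⟨v, -, hv⟩ := mem_ideal_span_X_image.1 hp 0 (mem_support_iff.2 h)
  exact hv rfl

theorem X_mem_span_iff [Nontrivial A] :
    (X w : MvPolynomial σ A) ∈ Ideal.span ((X : σ → MvPolynomial σ A) '' E) ↔ w ∈ E := by
  simp only [mem_ideal_span_X_image, support_X, Finset.mem_singleton, forall_eq,
    Finsupp.single_apply_ne_zero, ne_eq, one_ne_zero, not_false_eq_true, and_true,
    exists_eq_right]

theorem X_mem_monomialSubalgebra_guarded_iff [Nontrivial A] :
    (X w : MvPolynomial σ A) ∈ monomialSubalgebra A (guarded E v) ↔ (w = v → v ∈ E) := by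
  simp only [mem_monomialSubalgebra, support_X, Finset.mem_singleton, forall_eq, mem_guarded,
    Finsupp.single_apply_ne_zero, ne_eq, one_ne_zero, not_false_eq_true, and_true,
    exists_eq_right]
  grind

theorem forall_mem_support_killVars_iff {Q : (σ →₀ ℕ) → Prop} :
    (∀ s ∈ (killVars A E p).support, Q (s.mapDomain (↑))) ↔
      ∀ m ∈ p.support, (∀ w ∈ E, m w = 0) → Q m := by
  simp only [killVars, support_killCompl, Finset.mem_preimage]
  constructor
  · intro h m hm hE
    have hmE : (m.support : Set σ) ⊆ Set.range ((↑) : (Eᶜ : Set σ) → σ) := by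
      rw [Subtype.range_coe]
      exact fun w hw hwE => Finsupp.mem_support_iff.1 hw (hE w hwE)
    have hm' := Finsupp.mapDomain_comapDomain _ Subtype.val_injective m hmE
    exact hm' ▸ h _ (hm'.symm ▸ hm)
  · intro h s hs
    refine h _ hs fun w hw => Finsupp.mapDomain_of_notMem_range s w ?_
    rwa [Subtype.range_coe, Set.notMem_compl_iff]

theorem killVars_eq_zero_iff :
    killVars A E p = 0 ↔ p ∈ Ideal.span ((X : σ → MvPolynomial σ A) '' E) := by
  rw [← support_eq_empty, Finset.eq_empty_iff_forall_notMem, mem_ideal_span_X_image]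
  refine (forall_mem_support_killVars_iff (Q := fun _ => False)).trans ?_
  simp only [imp_false, not_forall, exists_prop, ne_eq]

theorem degreeOf_killVars_eq_zero_iff (hv : v ∉ E) :
    degreeOf (⟨v, hv⟩ : (Eᶜ : Set σ)) (killVars A E p) = 0 ↔
      p ∈ monomialSubalgebra A (guarded E v) := by
  have h := forall_mem_support_killVars_iff (E := E) (p := p) (Q := fun m => m v = 0)
  simp only [Finsupp.mapDomain_apply Subtype.val_injective _ (⟨v, hv⟩ : (Eᶜ : Set σ))] at h
  simp only [← Nat.le_zero, degreeOf_le_iff]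
  simp only [Nat.le_zero]
  rw [h, mem_monomialSubalgebra]
  refine forall₂_congr fun m _ => ?_
  rw [mem_guarded, ← not_imp_comm]
  simp only [not_exists, not_and, not_not]

end CommSemiring

section Integral

variable {A B C : Type*} [CommRing A] [IsDomain A] [CommRing B] [CommRing C] [Algebra B C]

theorem natDegree_map_eq_zero_of_isIntegral (φ : C →+* Polynomial A)
    (hB : ∀ b, (φ (algebraMap B C b)).natDegree = 0) {c : C} (hc : IsIntegral B c) :
    (φ c).natDegree = 0 := by
  have hφc : IsIntegral A (φ c) :=
    hc.map_of_comp_eq ((Polynomial.constantCoeff.comp φ).comp (algebraMap B C)) φ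
      (RingHom.ext fun b => (Polynomial.eq_C_of_natDegree_eq_zero (hB b)).symm)
  by_contra h
  refine Polynomial.transcendental (φ c) h ?_ hφc.isAlgebraic
  exact mem_nonZeroDivisors_of_ne_zero
    (Polynomial.leadingCoeff_ne_zero.2 (Polynomial.ne_zero_of_natDegree_gt (Nat.pos_of_ne_zero h)))

theorem degreeOf_map_eq_zero_of_isIntegral (φ : C →+* MvPolynomial σ A) (v : σ)
    (hB : ∀ b, degreeOf v (φ (algebraMap B C b)) = 0) {c : C} (hc : IsIntegral B c) :
    degreeOf v (φ c) = 0 := by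
  classical
  simp only [degreeOf_eq_natDegree] at hB ⊢
  exact natDegree_map_eq_zero_of_isIntegral
    ((optionEquivLeft A {w // w ≠ v}).toRingHom.comp
      ((rename (Equiv.optionSubtypeNe v).symm).toRingHom.comp φ)) hB hc

theorem mem_monomialSubalgebra_guarded_of_isIntegral [Algebra B (MvPolynomial σ A)]
    {E : Set σ} {v : σ} (hv : v ∉ E)
    (hB : ∀ b, algebraMap B (MvPolynomial σ A) b ∈ monomialSubalgebra A (guarded E v))
    {p : MvPolynomial σ A} (hp : IsIntegral B p) : p ∈ monomialSubalgebra A (guarded E v) := by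
  simp only [← degreeOf_killVars_eq_zero_iff hv] at hB ⊢
  exact degreeOf_map_eq_zero_of_isIntegral (killVars A E).toRingHom _ hB hp

end Integral

section Domain

variable {A : Type*} [CommRing A] [IsDomain A] {E : Set σ} {v : σ} {p f : MvPolynomial σ A}

theorem mem_monomialSubalgebra_guarded_of_mul_mem (hv : v ∉ E)
    (hf : f ∉ Ideal.span ((X : σ → MvPolynomial σ A) '' E))
    (h : p * f ∈ monomialSubalgebra A (guarded E v)) : p ∈ monomialSubalgebra A (guarded E v) := by
  by_cases hp : p ∈ Ideal.span ((X : σ → MvPolynomial σ A) '' E)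
  · exact mem_monomialSubalgebra_guarded_of_mem_span v hp
  · rw [← killVars_eq_zero_iff] at hp hf
    rw [← degreeOf_killVars_eq_zero_iff hv] at h ⊢
    rw [map_mul, degreeOf_mul_eq hp hf] at h
    exact Nat.eq_zero_of_add_eq_zero_right h

theorem X_mul_mem_monomialSubalgebra_guarded_iff (hv : v ∉ E) :
    X v * p ∈ monomialSubalgebra A (guarded E v) ↔
      p ∈ Ideal.span ((X : σ → MvPolynomial σ A) '' E) := by
  refine ⟨fun h => ?_, fun hp =>
    mem_monomialSubalgebra_guarded_of_mem_span v (Ideal.mul_mem_left _ _ hp)⟩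
  by_contra hp
  exact hv (X_mem_monomialSubalgebra_guarded_iff.1
    (mem_monomialSubalgebra_guarded_of_mul_mem hv hp h) rfl)

end Domain

end GuardedMonomials

end MonomialExample

namespace StarOperation

open FractionalIdeal

section Divisibility

variable {B K : Type*} [CommRing B] [Field K] [Algebra B K] [IsFractionRing B K]

theorem mem_range_algebraMap_of_mul_mem_range {a b : B} (ha : Prime a) (hab : ¬ a ∣ b) {x : K}
    (hxa : x * algebraMap B K a ∈ (algebraMap B K).range)
    (hxb : x * algebraMap B K b ∈ (algebraMap B K).range) : x ∈ (algebraMap B K).range := by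
  have hinj := IsFractionRing.injective B K
  obtain ⟨c, hc⟩ := hxa
  obtain ⟨d, hd⟩ := hxb
  have hcd : c * b = d * a := hinj (by rw [map_mul, map_mul, hc, hd, mul_right_comm])
  obtain ⟨e, rfl⟩ := (ha.dvd_or_dvd (Dvd.intro_left d hcd.symm)).resolve_right hab
  refine ⟨e, mul_right_cancel₀ ((map_ne_zero_iff _ hinj).2 ha.ne_zero) ?_⟩
  rw [← map_mul, mul_comm e a, hc]

end Divisibility

variable {R K : Type*} [CommRing R] [IsDomain R] [Field K] [Algebra R K] [IsFractionRing R K]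
  {I J : FractionalIdeal R⁰ K} {x : K}

theorem one_div_ne_zero (hI : I ≠ 0) : 1 / I ≠ 0 := by
  intro h
  have hpos := bot_lt_mul_inv hI
  rw [inv_eq, h, mul_zero] at hpos
  exact lt_irrefl _ hpos

theorem mem_div_coeIdeal_iff {I : Ideal R} (hI : (I : FractionalIdeal R⁰ K) ≠ 0) :
    x ∈ J / (I : FractionalIdeal R⁰ K) ↔ ∀ q ∈ I, x * algebraMap R K q ∈ J := by
  rw [mem_div_iff_of_ne_zero hI]
  refine ⟨fun h q hq => h _ (mem_coeIdeal_of_mem _ hq), fun h y hy => ?_⟩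
  obtain ⟨q, hq, rfl⟩ := (mem_coeIdeal _).1 hy
  exact h q hq

theorem mem_vClosure_iff (hI : I ≠ 0) :
    x ∈ vClosure I ↔ ∀ y ∈ 1 / I, x * y ∈ (1 : FractionalIdeal R⁰ K) :=
  mem_div_iff_of_ne_zero (one_div_ne_zero hI)

theorem le_vClosure (hI : I ≠ 0) : I ≤ vClosure I := by
  intro x hx
  refine (mem_vClosure_iff hI).2 fun y hy => ?_
  rw [mul_comm]
  exact (mem_div_iff_of_ne_zero hI).1 hy x hx

theorem vClosure_mono (hI : I ≠ 0) (hJ : J ≠ 0) (hIJ : I ≤ J) : vClosure I ≤ vClosure J :=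
  inv_anti_mono (one_div_ne_zero hJ) (one_div_ne_zero hI) (inv_anti_mono hI hJ hIJ)

theorem isDivisorial_spanSingleton (hx : x ≠ 0) : IsDivisorial (spanSingleton R⁰ x) := by
  refine ⟨spanSingleton_ne_zero_iff.2 hx, ?_⟩
  rw [vClosure, one_div_spanSingleton, one_div_spanSingleton, inv_inv]

theorem isDivisorial_one : IsDivisorial (1 : FractionalIdeal R⁰ K) := by
  rw [← spanSingleton_one]
  exact isDivisorial_spanSingleton one_ne_zero

theorem IsDivisorial.inf (hI : IsDivisorial I) (hJ : IsDivisorial J) (h : I ⊓ J ≠ 0) :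
    IsDivisorial (I ⊓ J) :=
  ⟨h, le_antisymm (le_inf ((vClosure_mono h hI.1 inf_le_left).trans_eq hI.2)
    ((vClosure_mono h hJ.1 inf_le_right).trans_eq hJ.2)) (le_vClosure h)⟩

theorem IsDivisorial.one_le_of_one_div_le_one (hI : IsDivisorial I) (h : 1 / I ≤ 1) : 1 ≤ I :=
  calc 1 = (1 : FractionalIdeal R⁰ K)⁻¹ := by rw [inv_eq, FractionalIdeal.div_one]
    _ ≤ vClosure I := inv_anti_mono (one_div_ne_zero hI.1) one_ne_zero h
    _ = I := hI.2

theorem eq_top_of_one_div_le_one {I : Ideal R} (hI : IsDivisorial (I : FractionalIdeal R⁰ K))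
    (h : 1 / (I : FractionalIdeal R⁰ K) ≤ 1) : I = ⊤ := by
  rw [← Ideal.one_eq_top, ← coeIdeal_eq_one (K := K)]
  exact le_antisymm coeIdeal_le_one (hI.one_le_of_one_div_le_one h)

theorem isStrong_of_one_div_le (hI : I ≠ 0) (hI1 : I ≤ 1) (h : 1 / I ≤ I / I) : IsStrong I := by
  refine ⟨hI, le_antisymm h fun x hx => ?_⟩
  rw [mem_div_iff_of_ne_zero hI] at hx ⊢
  exact fun y hy => hI1 (hx y hy)

theorem mem_tClosure_of_mem (hI : I ≠ 0) (hx : x ∈ I) : x ∈ tClosure I := by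
  have mem_of_ne_zero : ∀ y ∈ I, y ≠ 0 → ∀ w ∈ spanSingleton R⁰ y, w ∈ tClosure I := by
    intro y hy hy0 w hw
    have hne : spanSingleton R⁰ y ≠ 0 := spanSingleton_ne_zero_iff.2 hy0
    refine ⟨spanSingleton R⁰ y, hne, ?_, spanSingleton_le_iff_mem.2 hy, le_vClosure hne hw⟩
    rw [coe_spanSingleton]
    exact Submodule.fg_span_singleton y
  obtain rfl | hx0 := eq_or_ne x 0
  · obtain ⟨y, hy0, hy⟩ := exists_ne_zero_mem_isInteger hI
    exact mem_of_ne_zero _ hy ((map_ne_zero_iff _ (IsFractionRing.injective R K)).2 hy0) 0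
      (zero_mem _)
  · exact mem_of_ne_zero x hx hx0 x (mem_spanSingleton_self _ x)

theorem isTIdeal_of_vClosure_le (hI : I ≠ 0)
    (h : ∀ J : FractionalIdeal R⁰ K, J ≠ 0 → (J : Submodule R K).FG → J ≤ I → vClosure J ≤ I) :
    IsTIdeal I :=
  ⟨hI, Set.Subset.antisymm (fun _ ⟨J, hJ0, hJ, hJI, hx⟩ => h J hJ0 hJ hJI hx) fun _ hx =>
    mem_tClosure_of_mem hI hx⟩

theorem eventually_mem_div_of_fg {ι : Type*} {l : Filter ι} {u : ι → K} (hI : I ≠ 0)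
    (hfg : (I : Submodule R K).FG) (h : ∀ y ∈ I, ∀ᶠ i in l, u i * y ∈ J) :
    ∀ᶠ i in l, u i ∈ J / I := by
  obtain ⟨s, hs⟩ := hfg
  have hgen : ∀ᶠ i in l, ∀ y ∈ s, u i * y ∈ J :=
    (Filter.eventually_all_finset s).2 fun y hy =>
      h y (mem_coe.1 (hs ▸ Submodule.subset_span hy))
  filter_upwards [hgen] with i hi
  have hspan : (I : Submodule R K) ≤ (J : Submodule R K).comap (LinearMap.mulLeft R (u i)) :=
    hs ▸ Submodule.span_le.2 hi
  exact (mem_div_iff_of_ne_zero hI).2 fun y hy => hspan hy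

end StarOperation

namespace MonomialExample

open MvPolynomial Filter

/-- The variables `Y` and `X_i`, `i ≤ n`, one of which has to accompany `T_n` by condition (b). -/
def guardsT (n : ℕ+) : Set Var :=
  insert Var.Y (Var.X '' Set.Iic n)

/-- The monoid of monomials satisfying condition (b) alone; its monoid ring turns out to be
`R[Z]`. -/
noncomputable def tGuarded : AddSubmonoid (Var →₀ ℕ) :=
  ⨅ n, guarded (guardsT n) (Var.T n)

theorem T_notMem_guardsT (n m : ℕ+) : Var.T n ∉ guardsT m := by
  simp [guardsT]

theorem Z_notMem_range_X : Var.Z ∉ Set.range Var.X := by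
  simp

theorem monotone_guardsT : Monotone guardsT := fun _ _ h =>
  Set.insert_subset_insert (Set.image_mono (Set.Iic_subset_Iic.2 h))

theorem S_eq_inf : S = guarded (Set.range Var.X) Var.Z ⊓ tGuarded := by
  ext m
  simp only [tGuarded, guardsT, AddSubmonoid.mem_inf, AddSubmonoid.mem_iInf, mem_guarded,
    Set.exists_range_iff, Set.mem_insert_iff, exists_eq_or_imp, Set.exists_mem_image, Set.mem_Iic]
  rfl

theorem erase_Z_mem_S {m : Var →₀ ℕ} (hm : m ∈ tGuarded) : m.erase Var.Z ∈ S := by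
  rw [S_eq_inf]
  refine ⟨fun h => absurd Finsupp.erase_same h, ?_⟩
  simp only [tGuarded, AddSubmonoid.mem_iInf, SetLike.mem_coe] at hm ⊢
  exact fun n => erase_mem_guarded (hm n) (by simp [guardsT])

theorem eventually_exists_mem_guardsT {m : Var →₀ ℕ} (hm : m ∈ S) (h0 : m ≠ 0) :
    ∀ᶠ n in atTop, ∃ w ∈ guardsT n, m w ≠ 0 := by
  obtain ⟨n, w, hw, hmw⟩ : ∃ n, ∃ w ∈ guardsT n, m w ≠ 0 := by
    have hX : ∀ n, m (Var.X n) ≠ 0 → ∃ n, ∃ w ∈ guardsT n, m w ≠ 0 := fun n hn =>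
      ⟨n, Var.X n, Or.inr ⟨n, Set.self_mem_Iic, rfl⟩, hn⟩
    obtain ⟨v, hv⟩ := Finsupp.ne_iff.1 h0
    rcases v with _ | _ | n | n
    · exact ⟨1, Var.Y, Or.inl rfl, hv⟩
    · obtain ⟨n, hn⟩ := hm.1 hv
      exact hX n hn
    · exact hX n hv
    · rcases hm.2 n hv with hY | ⟨i, -, hi⟩
      · exact ⟨1, Var.Y, Or.inl rfl, hY⟩
      · exact hX i hi
  filter_upwards [eventually_ge_atTop n] with i hi
  exact ⟨w, monotone_guardsT hi hw, hmw⟩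

section Polynomials

variable {k : Type*} [Field k] {n : ℕ+} {p : MvPolynomial Var k}

theorem mem_R_iff : p ∈ R k ↔ p ∈ monomialSubalgebra k (guarded (Set.range Var.X) Var.Z) ∧
    p ∈ monomialSubalgebra k tGuarded := by
  rw [← mem_monomialSubalgebra_inf, ← S_eq_inf]
  rfl

theorem mem_P_iff {p : R k} :
    p ∈ P k ↔ (p : MvPolynomial Var k) ∈ Ideal.span (X '' Set.range Var.X) := by
  rw [← Set.range_comp]
  rfl

theorem mem_monomialSubalgebra_tGuarded_iff : p ∈ monomialSubalgebra k tGuarded ↔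
    ∀ n, p ∈ monomialSubalgebra k (guarded (guardsT n) (Var.T n)) :=
  mem_monomialSubalgebra_iInf

theorem X_mem_monomialSubalgebra_tGuarded {v : Var} (hv : ∀ n, v ≠ Var.T n) :
    X v ∈ monomialSubalgebra k tGuarded :=
  mem_monomialSubalgebra_tGuarded_iff.2 fun n =>
    X_mem_monomialSubalgebra_guarded_iff.2 fun h => absurd h (hv n)

theorem Z_mem_monomialSubalgebra_tGuarded : X Var.Z ∈ monomialSubalgebra k tGuarded :=
  X_mem_monomialSubalgebra_tGuarded fun _ => Var.noConfusion

theorem X_mem_R {v : Var} (hZ : v ≠ Var.Z) (hT : ∀ n, v ≠ Var.T n) : X v ∈ R k :=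
  mem_R_iff.2 ⟨X_mem_monomialSubalgebra_guarded_iff.2 fun h => absurd h hZ,
    X_mem_monomialSubalgebra_tGuarded hT⟩

theorem Y_mem_R : X Var.Y ∈ R k :=
  X_mem_R Var.noConfusion fun _ => Var.noConfusion

theorem Y_notMem_P : (⟨X Var.Y, Y_mem_R⟩ : R k) ∉ P k := fun h => by
  simpa only [Set.mem_range, reduceCtorEq, exists_false] using X_mem_span_iff.1 (mem_P_iff.1 h)

theorem X_mem_P (n : ℕ+) :
    (⟨X (Var.X n), X_mem_R Var.noConfusion fun _ => Var.noConfusion⟩ : R k) ∈ P k :=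
  mem_P_iff.2 (X_mem_span_iff.2 ⟨n, rfl⟩)

theorem Z_mul_mem_R_iff {p : R k} : X Var.Z * (p : MvPolynomial Var k) ∈ R k ↔ p ∈ P k := by
  rw [mem_R_iff, mem_P_iff, X_mul_mem_monomialSubalgebra_guarded_iff Z_notMem_range_X]
  exact and_iff_left (mul_mem Z_mem_monomialSubalgebra_tGuarded (mem_R_iff.1 p.2).2)

theorem T_mul_mem_R_iff {p : R k} : X (Var.T n) * (p : MvPolynomial Var k) ∈ R k ↔
    (p : MvPolynomial Var k) ∈ Ideal.span (X '' guardsT n) := by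
  obtain ⟨hZ, hT⟩ := mem_R_iff.1 p.2
  rw [mem_monomialSubalgebra_tGuarded_iff] at hT
  rw [mem_R_iff, mem_monomialSubalgebra_tGuarded_iff,
    ← X_mul_mem_monomialSubalgebra_guarded_iff (T_notMem_guardsT n n)]
  refine ⟨fun h => h.2 n, fun h =>
    ⟨mul_mem (X_mem_monomialSubalgebra_guarded_iff.2 Var.noConfusion) hZ, fun m => ?_⟩⟩
  obtain rfl | hmn := eq_or_ne m n
  · exact h
  · exact mul_mem (X_mem_monomialSubalgebra_guarded_iff.2 fun h =>
      absurd (Var.T.inj h).symm hmn) (hT m)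

theorem mem_monomialSubalgebra_tGuarded_of_forall_mul_X_mem
    (h : ∀ n, p * X (Var.X n) ∈ R k) : p ∈ monomialSubalgebra k tGuarded := by
  refine mem_monomialSubalgebra_tGuarded_iff.2 fun n => ?_
  refine mem_monomialSubalgebra_guarded_of_mul_mem (T_notMem_guardsT n n) ?_
    (mem_monomialSubalgebra_tGuarded_iff.1 (mem_R_iff.1 (h (n + 1))).2 n)
  rw [X_mem_span_iff]
  simp [guardsT]

theorem mul_mem_R_of_mem_P (hp : p ∈ monomialSubalgebra k tGuarded) {q : R k} (hq : q ∈ P k) :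
    p * q ∈ R k :=
  mem_R_iff.2 ⟨mem_monomialSubalgebra_guarded_of_mem_span _
    (Ideal.mul_mem_left _ p (mem_P_iff.1 hq)), mul_mem hp (mem_R_iff.1 q.2).2⟩

theorem mul_mem_P (hp : p ∈ monomialSubalgebra k tGuarded) {q : R k} (hq : q ∈ P k) :
    (⟨p * q, mul_mem_R_of_mem_P hp hq⟩ : R k) ∈ P k :=
  mem_P_iff.2 (Ideal.mul_mem_left _ p (mem_P_iff.1 hq))

theorem mem_R_of_mul_mem_R (hp : p ∈ monomialSubalgebra k tGuarded) {f : R k} (hf : f ∉ P k)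
    (h : p * f ∈ R k) : p ∈ R k :=
  mem_R_iff.2 ⟨mem_monomialSubalgebra_guarded_of_mul_mem Z_notMem_range_X
    (mt mem_P_iff.2 hf) (mem_R_iff.1 h).1, hp⟩

theorem mem_adjoin_Z_iff :
    p ∈ Algebra.adjoin (R k) {X Var.Z} ↔ p ∈ monomialSubalgebra k tGuarded := by
  refine ⟨fun hp => ?_, fun hp => ?_⟩
  · induction hp using Algebra.adjoin_induction with
    | mem p hp => exact Set.mem_singleton_iff.1 hp ▸ Z_mem_monomialSubalgebra_tGuarded
    | algebraMap r => exact (mem_R_iff.1 r.2).2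
    | add p q _ _ hp hq => exact add_mem hp hq
    | mul p q _ _ hp hq => exact mul_mem hp hq
  · rw [p.as_sum]
    refine Subalgebra.sum_mem _ fun m hm => ?_
    have hfactor : monomial m (coeff m p) =
        monomial (m.erase Var.Z) (coeff m p) * X Var.Z ^ m Var.Z := by
      rw [X_pow_eq_monomial, monomial_mul, mul_one, Finsupp.erase_add_single]
    rw [hfactor]
    have hS : m.erase Var.Z ∈ S := erase_Z_mem_S (mem_monomialSubalgebra.1 hp m hm)
    exact mul_mem
      (Subalgebra.algebraMap_mem _ (⟨_, monomial_mem_monomialSubalgebra hS _⟩ : R k))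
      (pow_mem (Algebra.self_mem_adjoin_singleton _ _) _)

theorem mem_M_iff {p : R k} : p ∈ M k ↔ constantCoeff (p : MvPolynomial Var k) = 0 := by
  classical
  constructor
  · suffices hM : M k ≤ RingHom.ker (constantCoeff.comp (R k).val.toRingHom) from
      fun hp => hM hp
    refine Ideal.span_le.2 ?_
    rintro p ⟨s, -, hs0, hp⟩
    exact (congrArg constantCoeff hp).trans ((constantCoeff_monomial s 1).trans (if_neg hs0))
  · intro h
    have hp : p = ∑ m : (p : MvPolynomial Var k).support, coeff m.1 (p : MvPolynomial Var k) •
        (⟨monomial m.1 1, monomial_mem_monomialSubalgebra (p.2 m m.2) 1⟩ : R k) := by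
      apply Subtype.ext
      conv_lhs => rw [(p : MvPolynomial Var k).as_sum, ← Finset.sum_coe_sort]
      rw [AddSubmonoidClass.coe_finsetSum]
      refine Finset.sum_congr rfl fun m _ => ?_
      rw [Subalgebra.coe_smul, smul_monomial, smul_eq_mul, mul_one]
    rw [hp]
    refine Ideal.sum_mem _ fun m _ => Submodule.smul_of_tower_mem _ _ (Ideal.subset_span
      ⟨m, p.2 m m.2, fun h0 => mem_support_iff.1 m.2 ?_, rfl⟩)
    rw [h0]
    exact h

theorem isMaximal_M : (M k).IsMaximal := by
  have hM : M k = RingHom.ker (constantCoeff.comp (R k).val.toRingHom) :=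
    Ideal.ext fun _ => mem_M_iff
  rw [hM]
  exact RingHom.ker_isMaximal_of_surjective _ fun c =>
    ⟨algebraMap k (R k) c, constantCoeff_C _ c⟩

theorem P_lt_M : P k < M k := by
  refine lt_of_le_not_ge (fun p hp => ?_) fun h =>
    Y_notMem_P (h (mem_M_iff.2 (constantCoeff_X k Var.Y)))
  exact mem_M_iff.2 (constantCoeff_eq_zero_of_mem_span (mem_P_iff.1 hp))

theorem eventually_T_mul_mem_R {p : R k} (hp : p ∈ M k) :
    ∀ᶠ n in atTop, X (Var.T n) * (p : MvPolynomial Var k) ∈ R k := by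
  simp only [T_mul_mem_R_iff, mem_ideal_span_X_image]
  refine (eventually_all_finset _).2 fun m hm => eventually_exists_mem_guardsT (p.2 m hm) ?_
  rintro rfl
  exact mem_support_iff.1 hm (mem_M_iff.1 hp)

theorem mem_M_of_T_mul_mem_R {p : R k} (h : X (Var.T n) * (p : MvPolynomial Var k) ∈ R k) :
    p ∈ M k :=
  mem_M_iff.2 (constantCoeff_eq_zero_of_mem_span (T_mul_mem_R_iff.1 h))

theorem isIntegrallyClosed_R : IsIntegrallyClosed (R k) := by
  rw [isIntegrallyClosed_iff (FractionRing (MvPolynomial Var k))]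
  intro x hx
  obtain ⟨p, rfl⟩ := IsIntegrallyClosed.isIntegral_iff.1 (hx.tower_top (A := MvPolynomial Var k))
  have hp : IsIntegral (R k) p := (isIntegral_algebraMap_iff
    (IsFractionRing.injective (MvPolynomial Var k) (FractionRing (MvPolynomial Var k)))).1 hx
  refine ⟨⟨p, mem_R_iff.2 ⟨?_, mem_monomialSubalgebra_tGuarded_iff.2 fun n => ?_⟩⟩, rfl⟩
  · exact mem_monomialSubalgebra_guarded_of_isIntegral Z_notMem_range_X
      (fun r => (mem_R_iff.1 r.2).1) hp
  · exact mem_monomialSubalgebra_guarded_of_isIntegral (T_notMem_guardsT n n)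
      (fun r => mem_monomialSubalgebra_tGuarded_iff.1 (mem_R_iff.1 r.2).2 n) hp

end Polynomials

section FractionalIdeals

open StarOperation

variable {k : Type*} [Field k] {K : Type*} [Field K] [Algebra (MvPolynomial Var k) K]
  [IsFractionRing (MvPolynomial Var k) K] {p : MvPolynomial Var k} {x : K}

theorem algebraMap_mem_one_iff :
    algebraMap (MvPolynomial Var k) K p ∈ (1 : FractionalIdeal (R k)⁰ K) ↔ p ∈ R k := by
  rw [FractionalIdeal.mem_one_iff]
  refine ⟨fun ⟨r, hr⟩ => ?_, fun hp => ⟨⟨p, hp⟩, rfl⟩⟩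
  rw [← IsFractionRing.injective (MvPolynomial Var k) K hr]
  exact r.2

variable (k K) in
theorem algebraMap_Z_ne_zero : algebraMap (MvPolynomial Var k) K (X Var.Z) ≠ 0 :=
  (map_ne_zero_iff _ (IsFractionRing.injective (MvPolynomial Var k) K)).2 (X_ne_zero _)

variable (k K) in
theorem coe_P_ne_zero : (P k : FractionalIdeal (R k)⁰ K) ≠ 0 :=
  FractionalIdeal.coeIdeal_ne_zero.2 <| Submodule.ne_bot_iff _ |>.2
    ⟨_, X_mem_P 1, fun h => X_ne_zero (Var.X 1) (congrArg Subtype.val h)⟩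

theorem algebraMap_mem_spanSingleton_inv_Z_iff {p : R k} :
    algebraMap (R k) K p ∈ FractionalIdeal.spanSingleton (R k)⁰
      (algebraMap (MvPolynomial Var k) K (X Var.Z))⁻¹ ↔ p ∈ P k := by
  rw [← Z_mul_mem_R_iff, FractionalIdeal.mem_spanSingleton, ← algebraMap_mem_one_iff (K := K),
    FractionalIdeal.mem_one_iff]
  refine exists_congr fun r => ?_
  rw [Algebra.smul_def, ← div_eq_mul_inv, div_eq_iff (algebraMap_Z_ne_zero k K), map_mul, mul_comm]
  rfl

theorem coe_P_eq : (P k : FractionalIdeal (R k)⁰ K) = FractionalIdeal.spanSingleton (R k)⁰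
    (algebraMap (MvPolynomial Var k) K (X Var.Z))⁻¹ ⊓ 1 := by
  ext x
  constructor
  · rw [FractionalIdeal.mem_coeIdeal]
    rintro ⟨p, hp, rfl⟩
    exact ⟨algebraMap_mem_spanSingleton_inv_Z_iff.2 hp, algebraMap_mem_one_iff.2 p.2⟩
  · rintro ⟨hx, hx1⟩
    obtain ⟨p, rfl⟩ := (FractionalIdeal.mem_one_iff _).1 hx1
    exact FractionalIdeal.mem_coeIdeal_of_mem _ (algebraMap_mem_spanSingleton_inv_Z_iff.1 hx)

theorem algebraMap_mem_P_div_P (hp : p ∈ monomialSubalgebra k tGuarded) :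
    algebraMap (MvPolynomial Var k) K p ∈
      (P k : FractionalIdeal (R k)⁰ K) / (P k : FractionalIdeal (R k)⁰ K) := by
  refine (mem_div_coeIdeal_iff (coe_P_ne_zero k K)).2 fun q hq => ?_
  exact (FractionalIdeal.mem_coeIdeal _).2
    ⟨_, mul_mem_P hp hq, map_mul (algebraMap (MvPolynomial Var k) K) p q⟩

theorem exists_algebraMap_eq_of_mem_one_div_P (hx : x ∈ 1 / (P k : FractionalIdeal (R k)⁰ K)) :
    ∃ p ∈ monomialSubalgebra k tGuarded, algebraMap (MvPolynomial Var k) K p = x := by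
  have hX : ∀ n, x * algebraMap (MvPolynomial Var k) K (X (Var.X n)) ∈
      (1 : FractionalIdeal (R k)⁰ K) := fun n =>
    (mem_div_coeIdeal_iff (coe_P_ne_zero k K)).1 hx _ (X_mem_P n)
  have hrange : ∀ n, x * algebraMap (MvPolynomial Var k) K (X (Var.X n)) ∈
      (algebraMap (MvPolynomial Var k) K).range := fun n => by
    obtain ⟨r, hr⟩ := (FractionalIdeal.mem_one_iff _).1 (hX n)
    exact ⟨r, hr⟩
  have hdvd : ¬ (X (Var.X 1) : MvPolynomial Var k) ∣ X (Var.X 2) := by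
    rw [X_dvd_X, Var.X.injEq]
    decide
  obtain ⟨p, rfl⟩ := mem_range_algebraMap_of_mul_mem_range X_prime hdvd (hrange 1) (hrange 2)
  simp only [← map_mul, algebraMap_mem_one_iff] at hX
  exact ⟨p, mem_monomialSubalgebra_tGuarded_of_forall_mul_X_mem hX, rfl⟩

theorem isStrong_P : IsStrong (P k : FractionalIdeal (R k)⁰ K) := by
  refine isStrong_of_one_div_le (coe_P_ne_zero k K) FractionalIdeal.coeIdeal_le_one fun x hx => ?_
  obtain ⟨p, hp, rfl⟩ := exists_algebraMap_eq_of_mem_one_div_P hx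
  exact algebraMap_mem_P_div_P hp

theorem mem_one_div_P_iff : x ∈ 1 / (P k : FractionalIdeal (R k)⁰ K) ↔
    ∃ p ∈ monomialSubalgebra k tGuarded, algebraMap (MvPolynomial Var k) K p = x := by
  refine ⟨exists_algebraMap_eq_of_mem_one_div_P, ?_⟩
  rintro ⟨p, hp, rfl⟩
  rw [isStrong_P.2]
  exact algebraMap_mem_P_div_P hp

theorem coe_one_div_P : ((1 / (P k : FractionalIdeal (R k)⁰ K) : FractionalIdeal (R k)⁰ K) :
      Submodule (R k) K) = Subalgebra.toSubmodule
    (Algebra.adjoin (R k) {algebraMap (MvPolynomial Var k) K (X Var.Z)}) := by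
  have hadjoin : Algebra.adjoin (R k) {algebraMap (MvPolynomial Var k) K (X Var.Z)} =
      (Algebra.adjoin (R k) {X Var.Z}).map
        (IsScalarTower.toAlgHom (R k) (MvPolynomial Var k) K) := by
    rw [AlgHom.map_adjoin_singleton, IsScalarTower.coe_toAlgHom']
  ext x
  rw [hadjoin, FractionalIdeal.mem_coe, Subalgebra.mem_toSubmodule, Subalgebra.mem_map,
    mem_one_div_P_iff]
  simp only [mem_adjoin_Z_iff, IsScalarTower.coe_toAlgHom']

theorem isDivisorial_P : IsDivisorial (P k : FractionalIdeal (R k)⁰ K) := by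
  have hP := coe_P_ne_zero k K
  rw [coe_P_eq] at hP ⊢
  exact (isDivisorial_spanSingleton (inv_ne_zero (algebraMap_Z_ne_zero k K))).inf
    isDivisorial_one hP

theorem one_div_le_one_of_P_lt {I : Ideal (R k)} (hI : (I : FractionalIdeal (R k)⁰ K) ≠ 0)
    (hPI : P k < I) : 1 / (I : FractionalIdeal (R k)⁰ K) ≤ 1 := by
  intro x hx
  obtain ⟨f, hf, hfP⟩ := SetLike.exists_of_lt hPI
  have hxI := (mem_div_coeIdeal_iff hI).1 hx
  obtain ⟨p, hp, rfl⟩ := exists_algebraMap_eq_of_mem_one_div_P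
    ((mem_div_coeIdeal_iff (coe_P_ne_zero k K)).2 fun q hq => hxI q (hPI.le hq))
  refine algebraMap_mem_one_iff.2 (mem_R_of_mul_mem_R hp hfP ?_)
  rw [← algebraMap_mem_one_iff (K := K), map_mul]
  exact hxI f hf

theorem isMaximalDivisorial_P : IsMaximalDivisorial K (P k) := by
  refine ⟨⟨(P_lt_M.trans_le le_top).ne, isDivisorial_P⟩, ?_⟩
  rintro I ⟨hItop, hI⟩ hPI
  by_contra hIP
  exact hItop (eq_top_of_one_div_le_one hI
    (one_div_le_one_of_P_lt hI.1 (lt_of_le_not_ge hPI hIP)))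

theorem vClosure_le_M {J : FractionalIdeal (R k)⁰ K} (hJ : J ≠ 0)
    (hfg : (J : Submodule (R k) K).FG) (hJM : J ≤ (M k : FractionalIdeal (R k)⁰ K)) :
    vClosure J ≤ (M k : FractionalIdeal (R k)⁰ K) := by
  have hT : ∀ᶠ n in atTop, algebraMap (MvPolynomial Var k) K (X (Var.T n)) ∈ 1 / J := by
    refine eventually_mem_div_of_fg hJ hfg fun y hy => ?_
    obtain ⟨p, hp, rfl⟩ := (FractionalIdeal.mem_coeIdeal _).1 (hJM hy)
    filter_upwards [eventually_T_mul_mem_R hp] with n hn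
    exact (map_mul (algebraMap (MvPolynomial Var k) K) _ _) ▸ algebraMap_mem_one_iff.2 hn
  obtain ⟨n, hn⟩ := hT.exists
  intro x hx
  obtain ⟨p, rfl⟩ := (FractionalIdeal.mem_one_iff _).1 <|
    isDivisorial_one.2.le (vClosure_mono hJ isDivisorial_one.1
      (hJM.trans FractionalIdeal.coeIdeal_le_one) hx)
  refine FractionalIdeal.mem_coeIdeal_of_mem _ (mem_M_of_T_mul_mem_R (n := n) ?_)
  rw [← algebraMap_mem_one_iff (K := K), map_mul, mul_comm]
  exact (mem_vClosure_iff hJ).1 hx _ hn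

theorem isTIdeal_M : IsTIdeal (M k : FractionalIdeal (R k)⁰ K) :=
  isTIdeal_of_vClosure_le (FractionalIdeal.coeIdeal_ne_zero.2 (bot_le.trans_lt P_lt_M).ne')
    fun _ => vClosure_le_M

theorem not_isTMaximal_P : ¬ IsTMaximal K (P k) := fun h =>
  P_lt_M.not_ge (h.2 ⟨isMaximal_M.ne_top, isTIdeal_M⟩ P_lt_M.le)

end FractionalIdeals

end MonomialExample

theorem mainTheorem2 (k : Type*) [Field k] (K : Type*) [Field K]
    [Algebra (MvPolynomial MonomialExample.Var k) K]
    [IsFractionRing (MvPolynomial MonomialExample.Var k) K]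
    (z : K) (hz : z = algebraMap (MvPolynomial MonomialExample.Var k) K
      (MvPolynomial.X MonomialExample.Var.Z)) :
    -- `R` is integrally closed
    IsIntegrallyClosed (MonomialExample.R k) ∧
    -- `P = R Z⁻¹ ∩ R`
    (MonomialExample.P k : FractionalIdeal (MonomialExample.R k)⁰ K) =
      FractionalIdeal.spanSingleton (MonomialExample.R k)⁰ z⁻¹ ⊓ 1 ∧
    -- `(R : P) = R[Z]`
    ((1 / (MonomialExample.P k : FractionalIdeal (MonomialExample.R k)⁰ K) :
        FractionalIdeal (MonomialExample.R k)⁰ K) : Submodule (MonomialExample.R k) K) =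
      Subalgebra.toSubmodule (Algebra.adjoin (MonomialExample.R k) {z}) ∧
    -- `P` is a strong maximal divisorial ideal
    StarOperation.IsStrong (MonomialExample.P k : FractionalIdeal (MonomialExample.R k)⁰ K) ∧
    StarOperation.IsMaximalDivisorial K (MonomialExample.P k) ∧
    -- `M = (S)R` is a maximal ideal and a `t`-ideal, and it properly contains `P`
    (MonomialExample.M k).IsMaximal ∧
    StarOperation.IsTIdeal (MonomialExample.M k : FractionalIdeal (MonomialExample.R k)⁰ K) ∧
    MonomialExample.P k < MonomialExample.M k ∧
    -- `P` is not `t`-maximal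
    ¬ StarOperation.IsTMaximal K (MonomialExample.P k) := by
  subst hz
  exact ⟨MonomialExample.isIntegrallyClosed_R, MonomialExample.coe_P_eq,
    MonomialExample.coe_one_div_P, MonomialExample.isStrong_P,
    MonomialExample.isMaximalDivisorial_P, MonomialExample.isMaximal_M,
    MonomialExample.isTIdeal_M, MonomialExample.P_lt_M, MonomialExample.not_isTMaximal_P⟩
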